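/- Work in first-order logic with equality. A theory is a set of sentences in a language with arbitrary (set-sized) families of relation and function symbols of finite arity; models are nonempty. Definitions. A theory $T'$ is a definitional extension of a theory $T$ if the language of $T'$ contains that of $T$ and $T'$ is logically equivalent to $T$ together with, for every additional symbol, one explicit definition by a formula $\delta$ of the language of $T$: $\forall \bar x\,(R(\bar x)\leftrightarrow\delta(\bar x))$ for a relation symbol $R$, and $\forall \bar x\, y\,(f(\bar x)=y\leftrightarrow\delta(\bar x,y))$ for a function symbol $f$, where in the latter case $T\vdash\forall\bar x\,\exists!y\,\delta(\bar x,y)$. Two theories are definitionally equivalent if there are copies of them (obtained by injectively renaming symbols) with disjoint languages which have a joint definitional extension. For a theory $T$, $\mathrm{Cat}(T)$ is the category whose objects are all models of $T$ and whose morphisms are all elementary embeddings; its forgetful functor to $\mathrm{Set}$ sends a model to its universe and an elementary embedding to its underlying function. A functor $F:\mathrm{Cat}(T_1)\to\mathrm{Cat}(T_2)$ is concrete if it commutes (strictly) with the forgetful functors, i.e. $M$ and $F(M)$ always have the same universe, and $h$ and $F(h)$ are always the same function. It is ultraproduct-preserving if $F(\prod_U M_i)=\prod_U F(M_i)$ (equality,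 not just isomorphism) for every set $I$, every ultrafilter $U$ on $I$ and every family $(M_i)_{i\in I}$ of models of $T_1$. Corollary. Let $T_1$ and $T_2$ be theories, in possibly different languages. Then $T_1$ and $T_2$ are definitionally equivalent if and only if there is a concrete, ultraproduct-preserving functor $F:\mathrm{Cat}(T_1)\to\mathrm{Cat}(T_2)$ that is an equivalence of categories. -/

import Mathlib

/-!
Conventions. The types in a fixed universe `u` play the role of the sets: the symbols of a language
form sets, and the models of a theory are all its nonempty models carried by a set.
A theory is an arbitrary set of first-order sentences (with equality) in a language with arbitrary
relation and function symbols of finite arity (constants are the nullary function symbols).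
-/

universe u

open CategoryTheory FirstOrder

namespace DefEq

open FirstOrder.Language

/-! ### Definitional extensions and definitional equivalence -/

section Definitional

/-- The universal closure `∀ x, φ(x)` of a formula with finitely many free variables. -/
noncomputable def univClosure {L : FirstOrder.Language.{u, u}} {α : Type} [Finite α]
    (φ : L.Formula α) : L.Sentence :=
  Formula.iAlls α (φ.relabel (Sum.inr : α → Empty ⊕ α))

/-- The explicit definition `∀ x, R(x) ↔ δ(x)` of a relation symbol `R` of `L'` by a formula `δ` of
`L`, where `L` is regarded as a part of `L'` through `e`. -/
noncomputable def relDefinition {L L' : FirstOrder.Language.{u, u}} (e : L →ᴸ L') {n : ℕ}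
    (R : L'.Relations n) (δ : L.Formula (Fin n)) : L'.Sentence :=
  univClosure ((R.formula (fun i => Term.var i)).iff (e.onFormula δ))

/-- The explicit definition `∀ x y, f(x) = y ↔ δ(x, y)` of a function symbol `f` of `L'` by a
formula `δ` of `L`, where `L` is regarded as a part of `L'` through `e`. -/
noncomputable def funDefinition {L L' : FirstOrder.Language.{u, u}} (e : L →ᴸ L') {n : ℕ}
    (f : L'.Functions n) (δ : L.Formula (Fin n ⊕ Unit)) : L'.Sentence :=
  univClosure
    (((Term.func f (fun i => Term.var (Sum.inl i))).equal (Term.var (Sum.inr ()))).iff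
      (e.onFormula δ))

/-- `IsDefinitionalExtension e T T'`: regarding the language `L` of `T` as a part of the language
`L'` of `T'` through the (injective) renaming `e`, the theory `T'` is a definitional extension of
`T`. That is, `T'` is logically equivalent to `T` together with one explicit definition, by an
`L`-formula, of each symbol of `L'` that is not in `L`; a formula defining a function symbol has to
be provably functional in `T`. (The formulas that `ρ` and `γ` assign to symbols which are already
in `L` are not used.) -/
def IsDefinitionalExtension {L L' : FirstOrder.Language.{u, u}} (e : L →ᴸ L') (T : L.Theory)
    (T' : L'.Theory) : Prop :=
  ∃ (ρ : ∀ n : ℕ, L'.Relations n → L.Formula (Fin n))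
    (γ : ∀ n : ℕ, L'.Functions n → L.Formula (Fin n ⊕ Unit)),
    (∀ (n : ℕ) (f : L'.Functions n), f ∉ Set.range (fun g : L.Functions n => e.onFunction g) →
      T ⊨ᵇ (γ n f).iExsUnique Unit) ∧
    ∀ σ : L'.Sentence,
      T' ⊨ᵇ σ ↔
        (e.onTheory T ∪
          {τ | ∃ (n : ℕ) (R : L'.Relations n),
            R ∉ Set.range (fun S : L.Relations n => e.onRelation S) ∧
              τ = relDefinition e R (ρ n R)} ∪
          {τ | ∃ (n : ℕ) (f : L'.Functions n),
            f ∉ Set.range (fun g : L.Functions n => e.onFunction g) ∧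
              τ = funDefinition e f (γ n f)}) ⊨ᵇ σ

/-- Two theories are definitionally equivalent when there are copies of them with disjoint languages
which have a joint definitional extension. The copies are given by injective renamings `e₁`, `e₂` of
the two languages into the language `L'` of the joint extension, with disjoint images. -/
def DefinitionallyEquivalent {L₁ L₂ : FirstOrder.Language.{u, u}} (T₁ : L₁.Theory)
    (T₂ : L₂.Theory) : Prop :=
  ∃ (L' : FirstOrder.Language.{u, u}) (e₁ : L₁ →ᴸ L') (e₂ : L₂ →ᴸ L') (T' : L'.Theory),
    e₁.Injective ∧ e₂.Injective ∧
    (∀ n : ℕ, Disjoint (Set.range (fun f : L₁.Functions n => e₁.onFunction f))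
      (Set.range (fun f : L₂.Functions n => e₂.onFunction f))) ∧
    (∀ n : ℕ, Disjoint (Set.range (fun R : L₁.Relations n => e₁.onRelation R))
      (Set.range (fun R : L₂.Relations n => e₂.onRelation R))) ∧
    IsDefinitionalExtension e₁ T₁ T' ∧ IsDefinitionalExtension e₂ T₂ T'

end Definitional

/-! ### Model categories, concrete functors, ultraproducts -/

section ModelCategory

/-- The model category of `T`; its objects are all (nonempty) models of `T`. -/
abbrev ModelCat {L : FirstOrder.Language.{u, u}} (T : L.Theory) : Type (u + 1) :=
  Theory.ModelType.{u, u, u} T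

/-- The morphisms of the model category of `T` are all elementary embeddings. -/
instance instCategoryModelCat {L : FirstOrder.Language.{u, u}} (T : L.Theory) :
    Category.{u} (ModelCat T) where
  Hom M N := M ↪ₑ[L] N
  id M := ElementaryEmbedding.refl L M
  comp f g := ElementaryEmbedding.comp g f

/-- The forgetful functor of a model category: it sends a model to its universe and an elementary
embedding to its underlying function. -/
def forgetful {L : FirstOrder.Language.{u, u}} (T : L.Theory) : ModelCat T ⥤ Type u where
  obj M := M.Carrier
  map {M N} f := TypeCat.ofHom (fun x : M.Carrier => (show M ↪ₑ[L] N from f) x)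

/-- A functor between model categories is concrete when it commutes with the forgetful functors
(strictly: a model and its image have the same universe, a morphism and its image are the same
function). -/
def IsConcrete {L₁ L₂ : FirstOrder.Language.{u, u}} {T₁ : L₁.Theory} {T₂ : L₂.Theory}
    (F : ModelCat T₁ ⥤ ModelCat T₂) : Prop :=
  F ⋙ forgetful T₂ = forgetful T₁

/-- The `U`-ultraproduct of a family of models of `T`, as a model of `T`. -/
def ultraproduct {L : FirstOrder.Language.{u, u}} {T : L.Theory} {I : Type u} (U : Ultrafilter I)
    (M : I → ModelCat T) : ModelCat T :=
  haveI : ((U : Filter I).Product fun i => (M i).Carrier) ⊨ T :=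
    ⟨fun σ hσ => (Ultraproduct.sentence_realize σ).2
      (Filter.Eventually.of_forall fun i => (M i).is_model.realize_of_mem σ hσ)⟩
  Theory.ModelType.of T ((U : Filter I).Product fun i => (M i).Carrier)

/-- `F` preserves ultraproducts (on the nose, not only up to isomorphism). -/
def PreservesUltraproducts {L₁ L₂ : FirstOrder.Language.{u, u}} {T₁ : L₁.Theory} {T₂ : L₂.Theory}
    (F : ModelCat T₁ ⥤ ModelCat T₂) : Prop :=
  ∀ (I : Type u) (U : Ultrafilter I) (M : I → ModelCat T₁),
    F.obj (ultraproduct U M) = ultraproduct U (fun i => F.obj (M i))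

end ModelCategory

end DefEq

/-! Both conditions are compared with a third, `ConcreteEquiv`: a strict bijection between the
models of the two theories that keeps universes, makes the same functions elementary, and commutes
with ultraproducts.

From a functor to definitions: for a relation symbol `R` of the second language, "`R` holds of this
tuple in the image of `M`" is a property of tuples in models `M` of the first theory. Concreteness
makes it invariant under elementary embeddings, and preservation of ultraproducts together with Łoś
makes it compatible with ultraproducts. Such a property depends only on the type of the tuple,
because tuples of equal type are identified in a common elementary extension, and two uses of
compactness then yield one defining formula (`exists_definition_of_type_u`). Function symbols are
treated through their graphs. The inverse correspondence defines the symbols of the first language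
in the same way, and both systems of definitions over the sum language have the same models: the
pairs (model, its image) on one universe.

From definitions to a functor: reduct from a definitional extension is such a bijection. Expansions
exist because the definitions are functional; elementary maps agree because every formula of the
larger language translates back. The inverse of one reduct is composed with the other. -/

namespace DefEq

open FirstOrder.Language

/-! ### Compactness by ultraproducts, and a definability criterion -/

section Compactness

variable {L : FirstOrder.Language.{u, u}} {T : L.Theory}

/-- The tuple in an ultraproduct represented by a family of tuples in the factors. -/
def ultraTuple {I : Type u} (U : Ultrafilter I) (M : I → ModelCat T) {α : Type*}
    (x : ∀ i, α → M i) : α → ultraproduct U M :=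
  fun a => ((fun i => x i a : ∀ i, (M i).Carrier) : (U : Filter I).Product fun i => (M i).Carrier)

theorem realize_ultraTuple {I : Type u} (U : Ultrafilter I) (M : I → ModelCat T) {α : Type*}
    (x : ∀ i, α → M i) (φ : L.Formula α) :
    φ.Realize (ultraTuple U M x) ↔ ∀ᶠ i in (U : Filter I), φ.Realize (x i) :=
  Ultraproduct.realize_formula_cast (M := fun i => (M i).Carrier) (u := U) φ (fun a i => x i a)

/-- Compactness, for a class of models with a distinguished tuple closed under ultraproducts. -/
theorem exists_realize_of_finite {α : Type u} (K : ∀ M : ModelCat T, (α → M) → Prop)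
    (hK : ∀ (I : Type u) (U : Ultrafilter I) (M : I → ModelCat T) (x : ∀ i, α → M i),
      (∀ i, K (M i) (x i)) → K (ultraproduct U M) (ultraTuple U M x))
    (p : Set (L.Formula α))
    (hp : ∀ s : Finset (L.Formula α), ↑s ⊆ p → ∃ M v, K M v ∧ ∀ φ ∈ s, φ.Realize v) :
    ∃ M v, K M v ∧ ∀ φ ∈ p, φ.Realize v := by
  classical
  have h : ∀ s : Finset p, ∃ M v, K M v ∧ ∀ φ ∈ s, φ.1.Realize v := by
    intro s
    obtain ⟨M, v, hv, hs⟩ := hp (s.map (Function.Embedding.subtype _)) (by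
      intro φ hφ
      simp only [Finset.coe_map, Set.mem_image] at hφ
      obtain ⟨ψ, -, rfl⟩ := hφ
      exact ψ.2)
    exact ⟨M, v, hv, fun φ hφ => hs _ (Finset.mem_map_of_mem _ hφ)⟩
  choose M v hv hs using h
  -- Any ultrafilter refining `atTop` contains, for each `φ` in `p`, the finite subsets having `φ`
  -- as a member; on these `φ` holds.
  let U : Ultrafilter (Finset p) := Ultrafilter.of Filter.atTop
  refine ⟨ultraproduct U M, ultraTuple U M v, hK _ U M v hv, fun φ hφ => ?_⟩
  rw [realize_ultraTuple]
  refine Ultrafilter.of_le _ ?_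
  filter_upwards [Filter.eventually_ge_atTop {(⟨φ, hφ⟩ : p)}] with s hs'
  exact hs s ⟨φ, hφ⟩ (Finset.singleton_subset_iff.1 hs')

/-- A map preserving the truth of formulas is an elementary embedding. -/
def elementaryOfPreserves {M N : ModelCat T} (f : M → N)
    (hf : ∀ φ : L.Formula M, φ.Realize id → φ.Realize f) : M ↪ₑ[L] N where
  toFun := f
  map_formula' n φ x := by
    have h (ψ : L.Formula (Fin n)) : ψ.Realize x → ψ.Realize (f ∘ x) := fun hψ => by
      simpa using hf (ψ.relabel x) (by simpa using hψ)
    -- Preservation of the negation gives reflection.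
    refine ⟨fun h1 => ?_, h φ⟩
    by_contra h2
    exact (h φ.not (by simpa using h2)) h1

/-- If `a` satisfies every formula satisfied by `b`, then a formula satisfied by `b` together with
further elements of `N` is satisfied by `a` together with suitable further elements of `M`. -/
theorem exists_realize_of_same_type {α : Type*} {M N : ModelCat T} (a : α → M) (b : α → N)
    (hab : ∀ φ : L.Formula α, φ.Realize b → φ.Realize a) {β : Type*} (φ : L.Formula (α ⊕ β))
    (w : β → N) (hφ : φ.Realize (Sum.elim b w)) : ∃ y : β → M, φ.Realize (Sum.elim a y) := by
  classical
  -- Only finitely many variables can be quantified. The block is indexed by all free variables of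
  -- `φ`; the copies of those from `α` are dummies.
  let g : φ.freeVarFinset → α ⊕ φ.freeVarFinset := fun x =>
    match x with
    | ⟨Sum.inl i, _⟩ => Sum.inl i
    | ⟨Sum.inr j, h⟩ => Sum.inr ⟨Sum.inr j, h⟩
  let ψ : L.Formula (α ⊕ φ.freeVarFinset) := φ.restrictFreeVar g
  have hψ : (ψ.iExs φ.freeVarFinset).Realize b := by
    rw [Formula.realize_iExs]
    refine ⟨fun x => Sum.elim b w x.1, ?_⟩
    refine (BoundedFormula.realize_restrictFreeVar (Sum.elim b w) ?_).2 hφ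
    rintro ⟨i | j, h⟩ <;> rfl
  have := hab _ hψ
  rw [Formula.realize_iExs] at this
  obtain ⟨y, hy⟩ := this
  let y' : β → M := fun j =>
    if h : Sum.inr j ∈ φ.freeVarFinset then y ⟨Sum.inr j, h⟩ else Classical.arbitrary M
  refine ⟨y', (BoundedFormula.realize_restrictFreeVar (Sum.elim a y') ?_).1 hy⟩
  rintro ⟨i | j, h⟩
  · rfl
  · simp [g, y', h]

/-- Two models with tuples of the same type have a common elementary extension in which these
tuples coincide. -/
theorem exists_amalgam {α : Type*} {M N : ModelCat T} (a : α → M) (b : α → N)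
    (hab : ∀ φ : L.Formula α, φ.Realize b → φ.Realize a) :
    ∃ (P : ModelCat T) (f : M ↪ₑ[L] P) (g : N ↪ₑ[L] P), f ∘ a = g ∘ b := by
  classical
  -- The elementary diagram of `M` is imposed through the class of models, and that of `N`, with the
  -- names from `α` now read in `M` by `a`, through the set of formulas. Finitely many of the latter
  -- are realized in `M` itself. The equations between `i` and `b i` in that set force the two
  -- embeddings to agree on the tuples.
  obtain ⟨P, v, hv, hp⟩ := exists_realize_of_finite (T := T) (α := M.Carrier ⊕ N.Carrier)
    (fun P v => ∀ φ : L.Formula M, φ.Realize id → φ.Realize (v ∘ Sum.inl))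
    (fun I U Q x hx φ hφ =>
      (realize_ultraTuple U Q (fun i => x i ∘ Sum.inl) φ).2
        (Filter.Eventually.of_forall fun i => hx i φ hφ))
    ((fun φ : L.Formula (α ⊕ N) => φ.relabel (Sum.map a id)) '' {φ | φ.Realize (Sum.elim b id)})
    (by
      intro s hs
      obtain ⟨t, ht, rfl⟩ := Finset.subset_set_image_iff.1 hs
      have h1 : (Formula.iInf fun φ : t => φ.1).Realize (Sum.elim b id) := by
        rw [Formula.realize_iInf]
        exact fun φ => ht φ.2
      obtain ⟨y, hy⟩ := exists_realize_of_same_type a b hab _ _ h1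
      rw [Formula.realize_iInf] at hy
      refine ⟨M, Sum.elim id y, fun φ hφ => hφ, fun φ hφ => ?_⟩
      obtain ⟨ψ, hψ, rfl⟩ := Finset.mem_image.1 hφ
      rw [Formula.realize_relabel, Sum.elim_comp_map]
      exact hy ⟨ψ, hψ⟩)
  have hp' (φ : L.Formula (α ⊕ N)) (h : φ.Realize (Sum.elim b id)) :
      φ.Realize (v ∘ Sum.map a id) := by
    simpa using hp _ ⟨φ, h, rfl⟩
  refine ⟨P, elementaryOfPreserves (v ∘ Sum.inl) hv, elementaryOfPreserves (v ∘ Sum.inr)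
    fun φ hφ => ?_, funext fun i => ?_⟩
  · have := hp' (φ.relabel Sum.inr) (by simpa using hφ)
    rwa [Formula.realize_relabel] at this
  · have := hp' (((Term.var (Sum.inl i)).equal (Term.var (Sum.inr (b i)))))
      (by simp [Formula.realize_equal])
    exact Formula.realize_equal.1 this

/-- A property of tuples in models of `T` which is invariant under elementary embeddings and
compatible with ultraproducts is uniformly definable by a formula. -/
theorem exists_definition_of_type_u {α : Type u} (K : ∀ M : ModelCat T, (α → M) → Prop)
    (hemb : ∀ (M N : ModelCat T) (f : M ↪ₑ[L] N) (v : α → M), K N (f ∘ v) ↔ K M v)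
    (hult : ∀ (I : Type u) (U : Ultrafilter I) (M : I → ModelCat T) (x : ∀ i, α → M i),
      K (ultraproduct U M) (ultraTuple U M x) ↔ ∀ᶠ i in (U : Filter I), K (M i) (x i)) :
    ∃ δ : L.Formula α, ∀ (M : ModelCat T) (v : α → M), K M v ↔ δ.Realize v := by
  classical
  have htype (M N : ModelCat T) (a : α → M) (b : α → N)
      (hab : ∀ φ : L.Formula α, φ.Realize b → φ.Realize a) : K M a ↔ K N b := by
    obtain ⟨P, f, g, h⟩ := exists_amalgam a b hab
    rw [← hemb M P f, ← hemb N P g, h]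
  -- If no formula true of `v` implied `K`, compactness in the complement of `K` would give a tuple
  -- of the same type as `v` outside `K`. The complement is closed under ultraproducts by `hult`.
  have hloc (M : ModelCat T) (v : α → M) (hv : K M v) :
      ∃ δ : L.Formula α, δ.Realize v ∧ ∀ (N : ModelCat T) (w : α → N), δ.Realize w → K N w := by
    by_contra! hcon
    obtain ⟨N, w, hw, hall⟩ := exists_realize_of_finite (fun M v => ¬ K M v)
      (fun I U M x hx => by
        rw [hult, Ultrafilter.eventually_not.symm]
        exact Filter.Eventually.of_forall hx)
      {φ | φ.Realize v} (by
        intro s hs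
        obtain ⟨N, w, h1, h2⟩ := hcon (Formula.iInf fun φ : s => φ.1) (by
          rw [Formula.realize_iInf]
          exact fun φ => hs φ.2)
        rw [Formula.realize_iInf] at h1
        exact ⟨N, w, h2, fun φ hφ => h1 ⟨φ, hφ⟩⟩)
    exact hw ((htype N M w v hall).2 hv)
  -- If no finite disjunction from `Δ` defines `K`, compactness inside `K` gives a tuple refuting
  -- all of `Δ`, contrary to `hloc`.
  let Δ : Set (L.Formula α) := {δ | ∀ (N : ModelCat T) (w : α → N), δ.Realize w → K N w}
  by_contra! hcon
  obtain ⟨N, w, hw, hall⟩ := exists_realize_of_finite K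
    (fun I U M x hx => (hult I U M x).2 (Filter.Eventually.of_forall hx))
    (Formula.not '' Δ) (by
      intro s hs
      obtain ⟨t, ht, rfl⟩ := Finset.subset_set_image_iff.1 hs
      obtain ⟨M, v, hMv⟩ := hcon (Formula.iSup fun φ : t => φ.1)
      rw [Formula.realize_iSup] at hMv
      have hn : ∀ φ : t, ¬ φ.1.Realize v := fun φ hφ => by
        have := ht φ.2 M v hφ
        rcases hMv with h | h
        · exact h.2 ⟨φ, hφ⟩
        · exact h.1 this
      refine ⟨M, v, ?_, fun φ hφ => ?_⟩
      · rcases hMv with h | ⟨-, φ, hφ⟩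
        · exact h.1
        · exact absurd hφ (hn φ)
      · obtain ⟨ψ, hψ, rfl⟩ := Finset.mem_image.1 hφ
        exact Formula.realize_not.2 (hn ⟨ψ, hψ⟩))
  obtain ⟨δ, hδ, hδ'⟩ := hloc N w hw
  exact Formula.realize_not.1 (hall _ ⟨δ, hδ', rfl⟩) hδ

/-- The case of index types in `Type`, as used for the symbols of a language. -/
theorem exists_definition {α : Type} (K : ∀ M : ModelCat T, (α → M) → Prop)
    (hemb : ∀ (M N : ModelCat T) (f : M ↪ₑ[L] N) (v : α → M), K N (f ∘ v) ↔ K M v)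
    (hult : ∀ (I : Type u) (U : Ultrafilter I) (M : I → ModelCat T) (x : ∀ i, α → M i),
      K (ultraproduct U M) (ultraTuple U M x) ↔ ∀ᶠ i in (U : Filter I), K (M i) (x i)) :
    ∃ δ : L.Formula α, ∀ (M : ModelCat T) (v : α → M), K M v ↔ δ.Realize v := by
  obtain ⟨δ, hδ⟩ := exists_definition_of_type_u (T := T) (α := ULift.{u} α)
    (fun M v => K M (v ∘ ULift.up)) (fun M N f v => hemb M N f _)
    (fun I U M x => hult I U M fun i => x i ∘ ULift.up)
  exact ⟨δ.relabel ULift.down, fun M v => by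
    rw [Formula.realize_relabel, ← hδ M (v ∘ ULift.down)]; rfl⟩

end Compactness

/-! ### Strict correspondences between models, and concrete functors -/

section ConcreteEquivalence

/-- `f` is (the underlying function of) an elementary embedding. -/
def IsElem {L : FirstOrder.Language.{u, u}} {T : L.Theory} (M N : ModelCat T)
    (f : M.Carrier → N.Carrier) : Prop :=
  ∃ g : M ↪ₑ[L] N, ⇑g = f

theorem isElem_id {L : FirstOrder.Language.{u, u}} {T : L.Theory} (M : ModelCat T) :
    IsElem M M id :=
  ⟨ElementaryEmbedding.refl L M, rfl⟩

theorem IsElem.comp {L : FirstOrder.Language.{u, u}} {T : L.Theory} {M N P : ModelCat T}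
    {f : M.Carrier → N.Carrier} {g : N.Carrier → P.Carrier} (hg : IsElem N P g)
    (hf : IsElem M N f) : IsElem M P (g ∘ f) := by
  obtain ⟨g, rfl⟩ := hg
  obtain ⟨f, rfl⟩ := hf
  exact ⟨g.comp f, rfl⟩

theorem isElem_of_eq {L : FirstOrder.Language.{u, u}} {T : L.Theory} {M N : ModelCat T}
    (h : M = N) {f : M.Carrier → N.Carrier} (hf : HEq f (id : M.Carrier → M.Carrier)) :
    IsElem M N f := by
  subst h
  exact eq_of_heq hf ▸ isElem_id M

/-- An elementary identity map makes both structures interpret every symbol alike. This is the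
source of all strict equalities of models below. -/
theorem eq_of_isElem_id {L : FirstOrder.Language.{u, u}} {T : L.Theory} {A : Type u}
    {s t : L.Structure A} {hs : @Theory.Model L A s T} {ht : @Theory.Model L A t T}
    {ns nt : Nonempty A}
    (h : @IsElem L T (@Theory.ModelType.mk L T A s hs ns) (@Theory.ModelType.mk L T A t ht nt) id) :
    @Theory.ModelType.mk L T A s hs ns = @Theory.ModelType.mk L T A t ht nt := by
  obtain ⟨g, hg⟩ := h
  have hfun {n : ℕ} (f : L.Functions n) (x : Fin n → A) :=
    @ElementaryEmbedding.map_fun L A A s t g n f x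
  have hrel {n : ℕ} (R : L.Relations n) (x : Fin n → A) :=
    @ElementaryEmbedding.map_rel L A A s t g n R x
  have hg' : (@DFunLike.coe _ _ _ (@ElementaryEmbedding.instFunLike L A A s t) g) = id := hg
  have hst : s = t := by
    refine Structure.ext (funext fun n => funext fun f => funext fun x => ?_)
      (funext fun n => funext fun R => funext fun x => propext ?_)
    · have := hfun f x
      rwa [hg'] at this
    · have := hrel R x
      rw [hg'] at this
      exact this.symm
  subst hst
  rfl

/-- A correspondence between the models of two theories underlying a concrete
ultraproduct-preserving equivalence of model categories. -/
structure ConcreteEquiv {L₁ L₂ : FirstOrder.Language.{u, u}} (T₁ : L₁.Theory) (T₂ : L₂.Theory) where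
  /-- The structure put on the universe of a model. -/
  str : ∀ M : ModelCat T₁, L₂.Structure M.Carrier
  isModel : ∀ M : ModelCat T₁, @Theory.Model L₂ M.Carrier (str M) T₂
  isElem_iff : ∀ (M N : ModelCat T₁) (f : M.Carrier → N.Carrier),
    IsElem M N f ↔
      @IsElem L₂ T₂ (@Theory.ModelType.mk L₂ T₂ M.Carrier (str M) (isModel M) M.nonempty')
        (@Theory.ModelType.mk L₂ T₂ N.Carrier (str N) (isModel N) N.nonempty') f
  surj : ∀ N : ModelCat T₂, ∃ M : ModelCat T₁,
    @Theory.ModelType.mk L₂ T₂ M.Carrier (str M) (isModel M) M.nonempty' = N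
  ultra : ∀ (I : Type u) (U : Ultrafilter I) (M : I → ModelCat T₁),
    @Theory.ModelType.mk L₂ T₂ (ultraproduct U M).Carrier (str _) (isModel _)
      (ultraproduct U M).nonempty' =
    ultraproduct U fun i =>
      @Theory.ModelType.mk L₂ T₂ (M i).Carrier (str (M i)) (isModel (M i)) (M i).nonempty'

namespace ConcreteEquiv

variable {L₁ L₂ L₃ : FirstOrder.Language.{u, u}} {T₁ : L₁.Theory} {T₂ : L₂.Theory} {T₃ : L₃.Theory}

/-- The model of `T₂` corresponding to a model of `T₁`. -/
abbrev obj (C : ConcreteEquiv T₁ T₂) (M : ModelCat T₁) : ModelCat T₂ :=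
  @Theory.ModelType.mk L₂ T₂ M.Carrier (C.str M) (C.isModel M) M.nonempty'

/-- If the images coincide, the identity is elementary between them, hence between the original
models, since elementarity is reflected. -/
theorem obj_injective (C : ConcreteEquiv T₁ T₂) : Function.Injective C.obj := by
  intro M N h
  have hMN := congrArg Theory.ModelType.Carrier h
  obtain @⟨A, s, hs, ns⟩ := M
  obtain @⟨B, t, ht, nt⟩ := N
  change A = B at hMN
  subst hMN
  refine eq_of_isElem_id ((C.isElem_iff _ _ _).2 (isElem_of_eq h HEq.rfl))

theorem exists_str (C : ConcreteEquiv T₁ T₂) (N : ModelCat T₂) :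
    ∃ (s : L₁.Structure N.Carrier) (hs : @Theory.Model L₁ N.Carrier s T₁),
      C.obj (@Theory.ModelType.mk L₁ T₁ N.Carrier s hs N.nonempty') = N := by
  obtain ⟨M, rfl⟩ := C.surj N
  exact ⟨M.struc, M.is_model, rfl⟩

/-- The inverse correspondence. -/
noncomputable def symm (C : ConcreteEquiv T₁ T₂) : ConcreteEquiv T₂ T₁ where
  str N := (C.exists_str N).choose
  isModel N := (C.exists_str N).choose_spec.choose
  isElem_iff M N f := by
    rw [C.isElem_iff]
    have hM := (C.exists_str M).choose_spec.choose_spec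
    have hN := (C.exists_str N).choose_spec.choose_spec
    have (M' N' : ModelCat T₂) (hM : M' = M) (hN : N' = N) (f : M → N) (f' : M' → N')
      (hf : HEq f f') : IsElem M N f ↔ IsElem M' N' f' := by
      subst hM hN
      rw [eq_of_heq hf]
    exact this _ _ hM hN f f HEq.rfl
  surj M := ⟨C.obj M, C.obj_injective (C.exists_str (C.obj M)).choose_spec.choose_spec⟩
  ultra I U N := by
    apply C.obj_injective
    refine ((C.exists_str _).choose_spec.choose_spec).trans ((C.ultra I U _).trans ?_).symm
    congr 1
    funext i
    exact (C.exists_str (N i)).choose_spec.choose_spec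

theorem obj_symm_obj (C : ConcreteEquiv T₁ T₂) (N : ModelCat T₂) : C.obj (C.symm.obj N) = N :=
  (C.exists_str N).choose_spec.choose_spec

theorem symm_obj_obj (C : ConcreteEquiv T₁ T₂) (M : ModelCat T₁) : C.symm.obj (C.obj M) = M :=
  C.obj_injective (C.obj_symm_obj _)

/-- Composition of correspondences. -/
def trans (C : ConcreteEquiv T₁ T₂) (D : ConcreteEquiv T₂ T₃) : ConcreteEquiv T₁ T₃ where
  str M := D.str (C.obj M)
  isModel M := D.isModel (C.obj M)
  isElem_iff M N f := (C.isElem_iff M N f).trans (D.isElem_iff (C.obj M) (C.obj N) f)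
  surj P := by
    obtain ⟨N, rfl⟩ := D.surj P
    obtain ⟨M, rfl⟩ := C.surj N
    exact ⟨M, rfl⟩
  ultra I U M := (congrArg D.obj (C.ultra I U M)).trans (D.ultra I U fun i => C.obj (M i))

/-- The two bundled models have definitionally equal universes, so their equality descends to the
structures; Łoś can then be applied on the side of `T₂`. -/
theorem str_ultraproduct (C : ConcreteEquiv T₁ T₂) (I : Type u) (U : Ultrafilter I)
    (M : I → ModelCat T₁) :
    C.str (ultraproduct U M) = (ultraproduct U fun i => C.obj (M i)).struc := by
  have h := C.ultra I U M
  unfold ultraproduct Theory.ModelType.of at h ⊢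
  injection h

/-- The criterion applies: elementary embeddings of models of `T₁` are elementary for the images,
and Łoś for the images gives compatibility with ultraproducts. -/
theorem exists_relation_definition (C : ConcreteEquiv T₁ T₂) {n : ℕ} (R : L₂.Relations n) :
    ∃ δ : L₁.Formula (Fin n), ∀ (M : ModelCat T₁) (v : Fin n → M),
      (C.str M).RelMap R v ↔ δ.Realize v := by
  apply exists_definition
  · intro M N f v
    obtain ⟨g, hg⟩ := (C.isElem_iff M N f).1 ⟨f, rfl⟩
    rw [← hg]
    exact ElementaryEmbedding.map_rel (M := C.obj M) (N := C.obj N) g R v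
  · intro I U M x
    rw [C.str_ultraproduct]
    exact realize_ultraTuple U (fun i => C.obj (M i)) x (R.formula Term.var)

theorem exists_function_definition (C : ConcreteEquiv T₁ T₂) {n : ℕ} (f : L₂.Functions n) :
    ∃ δ : L₁.Formula (Fin n ⊕ Unit), ∀ (M : ModelCat T₁) (v : Fin n ⊕ Unit → M),
      (C.str M).funMap f (v ∘ Sum.inl) = v (Sum.inr ()) ↔ δ.Realize v := by
  apply exists_definition
  · intro M N h v
    obtain ⟨g, hg⟩ := (C.isElem_iff M N h).1 ⟨h, rfl⟩
    rw [← hg]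
    have := ElementaryEmbedding.map_fun (M := C.obj M) (N := C.obj N) g f (v ∘ Sum.inl)
    refine Iff.trans (Eq.congr_left ?_) (ElementaryEmbedding.injective g).eq_iff
    exact this.symm
  · intro I U M x
    rw [C.str_ultraproduct]
    exact Formula.realize_equal.symm.trans ((realize_ultraTuple U (fun i => C.obj (M i)) x
      ((Term.func f (fun i => Term.var (Sum.inl i))).equal (Term.var (Sum.inr ())))).trans
      (Filter.eventually_congr (Filter.Eventually.of_forall fun i => Formula.realize_equal)))

/-- An elementary embedding of models of `T₁` as one of the corresponding models of `T₂`. -/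
noncomputable def mapElem (C : ConcreteEquiv T₁ T₂) {M N : ModelCat T₁} (f : M ↪ₑ[L₁] N) :
    C.obj M ↪ₑ[L₂] C.obj N :=
  ((C.isElem_iff M N f).1 ⟨f, rfl⟩).choose

theorem coe_mapElem (C : ConcreteEquiv T₁ T₂) {M N : ModelCat T₁} (f : M ↪ₑ[L₁] N) :
    (⇑(C.mapElem f) : M.Carrier → N.Carrier) = f :=
  ((C.isElem_iff M N f).1 ⟨f, rfl⟩).choose_spec

/-- The functor given by a correspondence. -/
noncomputable def functor (C : ConcreteEquiv T₁ T₂) : ModelCat T₁ ⥤ ModelCat T₂ where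
  obj M := C.obj M
  map {M N} f := C.mapElem (M := M) (N := N) f
  map_id M := DFunLike.coe_injective (F := C.obj M ↪ₑ[L₂] C.obj M)
    (C.coe_mapElem (ElementaryEmbedding.refl L₁ M))
  map_comp {M N P} f g := DFunLike.coe_injective (F := C.obj M ↪ₑ[L₂] C.obj P) <|
    (C.coe_mapElem (ElementaryEmbedding.comp (M := M) (N := N) (P := P) g f)).trans
      (congrArg₂ (fun (a : N.Carrier → P.Carrier) (b : M.Carrier → N.Carrier) => a ∘ b)
        (C.coe_mapElem (M := N) (N := P) g) (C.coe_mapElem (M := M) (N := N) f)).symm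

theorem isConcrete_functor (C : ConcreteEquiv T₁ T₂) : IsConcrete C.functor := by
  refine CategoryTheory.Functor.hext (fun M => rfl) fun M N f => heq_of_eq ?_
  exact congrArg TypeCat.ofHom (C.coe_mapElem (M := M) (N := N) f)

theorem isEquivalence_functor (C : ConcreteEquiv T₁ T₂) : C.functor.IsEquivalence where
  faithful := ⟨fun {M N f g} h => DFunLike.coe_injective (F := M ↪ₑ[L₁] N) <| by
    have h' : C.mapElem (M := M) (N := N) f = C.mapElem (M := M) (N := N) g := h
    exact (C.coe_mapElem (M := M) (N := N) f).symm.trans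
      (h' ▸ C.coe_mapElem (M := M) (N := N) g)⟩
  full := ⟨fun {M N} g => by
    obtain ⟨f, hf⟩ := (C.isElem_iff M N (ElementaryEmbedding.toFun (M := C.obj M) (N := C.obj N) g)).2 ⟨g, rfl⟩
    exact ⟨f, DFunLike.coe_injective (F := C.obj M ↪ₑ[L₂] C.obj N)
      ((C.coe_mapElem (M := M) (N := N) f).trans hf)⟩⟩
  essSurj := ⟨fun N => by
    obtain ⟨M, hM⟩ := C.surj N
    exact ⟨M, ⟨eqToIso hM⟩⟩⟩

/-- Concreteness only gives a propositional equality of universes; this replaces the image by a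
model literally carried by `A`. -/
theorem exists_obj_eq {X : ModelCat T₂} {A : Type u} (h : X.Carrier = A) :
    ∃ (s : L₂.Structure A) (hs : @Theory.Model L₂ A s T₂) (ns : Nonempty A),
      X = @Theory.ModelType.mk L₂ T₂ A s hs ns := by
  subst h
  exact ⟨X.struc, X.is_model, X.nonempty', rfl⟩

theorem isElem_of_heq {X Y X' Y' : ModelCat T₂} (hX : X = X') (hY : Y = Y') (g : X ⟶ Y)
    (f : X'.Carrier → Y'.Carrier) (h : HEq ((forgetful T₂).map g)
      (show (X'.Carrier : Type u) ⟶ Y'.Carrier from TypeCat.ofHom f)) : IsElem X' Y' f := by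
  subst hX hY
  exact ⟨g, congrArg (fun k : X.Carrier ⟶ Y.Carrier => ⇑(ConcreteCategory.hom k)) (eq_of_heq h)⟩

theorem forgetful_map_heq {X Y X' Y' : ModelCat T₂} (hX : X = X') (hY : Y = Y') (g : X' ⟶ Y') :
    HEq ((forgetful T₂).map (eqToHom hX ≫ g ≫ eqToHom hY.symm)) ((forgetful T₂).map g) := by
  subst hX hY
  simp

/-- A concrete ultraproduct-preserving equivalence comes from a correspondence. -/
theorem nonempty_of_functor (F : ModelCat T₁ ⥤ ModelCat T₂) (hF : IsConcrete F)
    (hU : PreservesUltraproducts F) (hE : F.IsEquivalence) : Nonempty (ConcreteEquiv T₁ T₂) := by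
  have hcar (M : ModelCat T₁) : (F.obj M).Carrier = M.Carrier :=
    CategoryTheory.Functor.congr_obj hF M
  choose s hs ns hobj using fun M => exists_obj_eq (hcar M)
  have hmap {M N : ModelCat T₁} (f : M ↪ₑ[L₁] N) :
      IsElem (@Theory.ModelType.mk L₂ T₂ M.Carrier (s M) (hs M) (ns M))
        (@Theory.ModelType.mk L₂ T₂ N.Carrier (s N) (hs N) (ns N)) f :=
    isElem_of_heq (hobj M) (hobj N) (F.map f) f
      (CategoryTheory.Functor.hcongr_hom hF (X := M) (Y := N) f)
  have helem (M N : ModelCat T₁) (f : M.Carrier → N.Carrier) : IsElem M N f ↔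
      IsElem (@Theory.ModelType.mk L₂ T₂ M.Carrier (s M) (hs M) (ns M))
        (@Theory.ModelType.mk L₂ T₂ N.Carrier (s N) (hs N) (ns N)) f := by
    refine ⟨fun ⟨g, hg⟩ => hg ▸ hmap g, fun ⟨g, hg⟩ => ?_⟩
    -- Fullness lifts `g`; the inserted `eqToHom`s do not change the underlying function, so the
    -- lift has the same one.
    obtain ⟨k, hk⟩ := hE.full.map_surjective
      (eqToHom (hobj M) ≫ (show _ ⟶ _ from g) ≫ eqToHom (hobj N).symm)
    refine ⟨k, ?_⟩
    have h1 := CategoryTheory.Functor.hcongr_hom hF k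
    have h2 := forgetful_map_heq (hobj M) (hobj N) g
    rw [← hk] at h2
    rw [← hg]
    exact congrArg (fun k : M.Carrier ⟶ N.Carrier => ⇑(ConcreteCategory.hom k))
      (eq_of_heq (h1.symm.trans h2))
  refine ⟨⟨s, hs, helem, ?_, ?_⟩⟩
  · intro N
    -- Strict surjectivity from the essential one: the structure of `M` is carried along the
    -- bijection `e` to the universe of `N`. The image of the resulting `M'` equals `N`, because the
    -- identity factors as `e` after its inverse, both elementary.
    obtain ⟨M, ⟨i⟩⟩ := hE.essSurj.mem_essImage N
    let X : ModelCat T₂ := @Theory.ModelType.mk L₂ T₂ M.Carrier (s M) (hs M) (ns M)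
    let j : X ≅ N := eqToIso (hobj M).symm ≪≫ i
    let e : M.Carrier ≃ N.Carrier :=
      { toFun := ElementaryEmbedding.toFun (M := X) (N := N) j.hom
        invFun := ElementaryEmbedding.toFun (M := N) (N := X) j.inv
        left_inv := congrFun (congrArg (ElementaryEmbedding.toFun (M := X) (N := X)) j.hom_inv_id)
        right_inv :=
          congrFun (congrArg (ElementaryEmbedding.toFun (M := N) (N := N)) j.inv_hom_id) }
    let M' : ModelCat T₁ := Theory.ModelType.equivInduced e
    have he : IsElem M M' e :=
      ⟨@FirstOrder.Language.Equiv.toElementaryEmbedding L₁ M N.Carrier _ e.inducedStructure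
        e.inducedStructureEquiv, rfl⟩
    refine ⟨M', (eq_of_isElem_id ?_).symm⟩
    have hinv : IsElem N X e.symm := ⟨j.inv, rfl⟩
    have := ((helem M M' e).1 he).comp hinv
    exact (congrArg (IsElem N (@Theory.ModelType.mk L₂ T₂ N.Carrier (s M') (hs M') (ns M')))
      (funext e.apply_symm_apply)).mp this
  · intro I U M
    have := hU I U M
    rw [hobj] at this
    exact this.trans (congrArg (ultraproduct U) (funext fun i => hobj (M i)))

end ConcreteEquiv

end ConcreteEquivalence

/-! ### Translating terms and formulas through definitions of symbols -/

section Translation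

variable {L L' : FirstOrder.Language.{u, u}}

theorem realize_univClosure {α : Type} [Finite α] (φ : L.Formula α) (A : Type u)
    [L.Structure A] : A ⊨ univClosure φ ↔ ∀ v : α → A, φ.Realize v := by
  simp [univClosure, Sentence.Realize, Formula.realize_iAlls, Formula.realize_relabel,
    Function.comp_def]

variable {ι : Type*} {A : ι → Type u} [∀ i, L'.Structure (A i)] [∀ i, L.Structure (A i)]

/-- If the function symbols of `L'` are uniformly defined by formulas of `L`, then so are the terms
of `L'`. -/
theorem exists_term_translation
    (hf : ∀ (n : ℕ) (f : L'.Functions n), ∃ γ : L.Formula (Fin n ⊕ Unit),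
      ∀ i (x : Fin n → A i) (y : A i), Structure.funMap f x = y ↔
        γ.Realize (Sum.elim x fun _ => y)) {α : Type*} (t : L'.Term α) :
    ∃ ψ : L.Formula (α ⊕ Unit), ∀ i (v : α → A i) (y : A i),
      t.realize v = y ↔ ψ.Realize (Sum.elim v fun _ => y) := by
  induction t with
  | var a =>
    exact ⟨(Term.var (Sum.inl a)).equal (Term.var (Sum.inr ())), fun i v y => by
      simp [Formula.realize_equal]⟩
  | @func n f ts ih =>
    obtain ⟨γ, hγ⟩ := hf n f
    choose ψ hψ using ih
    -- There are values of the subterms, each described by its `ψ j`, at which the graph `γ` of `f`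
    -- gives the last variable.
    refine ⟨((Formula.iInf fun j => (ψ j).relabel (Sum.elim (fun a => Sum.inl (Sum.inl a))
        fun _ => Sum.inr j)) ⊓ γ.relabel (Sum.elim Sum.inr fun _ => Sum.inl (Sum.inr ()))).iExs
          (Fin n), fun i v y => ?_⟩
    have h1 (z : Fin n → A i) (j : Fin n) :
        (Sum.elim (Sum.elim v fun _ : Unit => y) z ∘
          Sum.elim (fun a => Sum.inl (Sum.inl a)) fun _ : Unit => Sum.inr j) =
          Sum.elim v fun _ => z j := by
      ext (a | a) <;> rfl
    have h2 (z : Fin n → A i) :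
        (Sum.elim (Sum.elim v fun _ : Unit => y) z ∘
          Sum.elim Sum.inr fun _ : Unit => Sum.inl (Sum.inr ())) = Sum.elim z fun _ => y := by
      ext (a | a) <;> rfl
    simp only [Formula.realize_iExs, Formula.realize_inf, Formula.realize_iInf,
      Formula.realize_relabel, h1, h2, ← hψ, ← hγ, Term.realize_func]
    exact ⟨fun h => ⟨_, fun j => rfl, h⟩, fun ⟨z, hz, h⟩ => (funext hz : _ = z) ▸ h⟩

/-- If the symbols of `L'` are uniformly defined by formulas of `L`, then so are the formulas
of `L'`. -/
theorem exists_formula_translation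
    (hf : ∀ (n : ℕ) (f : L'.Functions n), ∃ γ : L.Formula (Fin n ⊕ Unit),
      ∀ i (x : Fin n → A i) (y : A i), Structure.funMap f x = y ↔
        γ.Realize (Sum.elim x fun _ => y))
    (hr : ∀ (n : ℕ) (R : L'.Relations n), ∃ ρ : L.Formula (Fin n),
      ∀ i (x : Fin n → A i), Structure.RelMap R x ↔ ρ.Realize x)
    {α : Type*} {n : ℕ} (φ : L'.BoundedFormula α n) :
    ∃ ψ : L.BoundedFormula α n, ∀ i (v : α → A i) (x : Fin n → A i),
      φ.Realize v x ↔ ψ.Realize v x := by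
  -- Atomic cases are built as formulas whose bound variables are still free; this turns them back
  -- into bounded formulas.
  have hatom {n : ℕ} (χ : L.Formula (α ⊕ Fin n)) : ∃ ψ : L.BoundedFormula α n,
      ∀ i (v : α → A i) (x : Fin n → A i), ψ.Realize v x ↔ χ.Realize (Sum.elim v x) := by
    refine ⟨BoundedFormula.relabel (n := n) (k := 0) id χ, fun i v x => ?_⟩
    refine BoundedFormula.realize_relabel.trans (iff_of_eq ?_)
    rw [Formula.Realize]
    congr 1
    exact Subsingleton.elim _ _
  induction φ with
  | falsum => exact ⟨⊥, fun i v x => Iff.rfl⟩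
  | equal t₁ t₂ =>
    obtain ⟨ψ₁, h₁⟩ := exists_term_translation hf t₁
    obtain ⟨ψ₂, h₂⟩ := exists_term_translation hf t₂
    obtain ⟨ψ, hψ⟩ := hatom ((ψ₁ ⊓ ψ₂).iExs Unit)
    refine ⟨ψ, fun i v x => ?_⟩
    have (z : Unit → A i) : Sum.elim (Sum.elim v x) z = Sum.elim (Sum.elim v x) fun _ => z () := rfl
    simp only [hψ, Formula.realize_iExs, Formula.realize_inf]
    simp only [this, ← h₁, ← h₂]
    exact ⟨fun h => ⟨fun _ => _, h, rfl⟩, fun ⟨z, hz, h⟩ => hz.trans h.symm⟩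
  | @rel n k R ts =>
    obtain ⟨ρ, hρ⟩ := hr k R
    choose ψ hψ using fun j => exists_term_translation hf (ts j)
    obtain ⟨χ, hχ⟩ := hatom (((Formula.iInf fun j => (ψ j).relabel (Sum.elim Sum.inl
      fun _ => Sum.inr j)) ⊓ ρ.relabel Sum.inr).iExs (Fin k))
    refine ⟨χ, fun i v x => ?_⟩
    have h1 (z : Fin k → A i) (j : Fin k) :
        (Sum.elim (Sum.elim v x) z ∘ Sum.elim Sum.inl fun _ : Unit => Sum.inr j) =
          Sum.elim (Sum.elim v x) fun _ => z j := by
      ext (a | a) <;> rfl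
    simp only [hχ, Formula.realize_iExs, Formula.realize_inf, Formula.realize_iInf,
      Formula.realize_relabel, h1, ← hψ, Sum.elim_comp_inr, ← hρ]
    exact ⟨fun h => ⟨_, fun j => rfl, h⟩, fun ⟨z, hz, h⟩ => by obtain rfl : _ = z := funext hz; exact h⟩
  | imp _ _ ih₁ ih₂ =>
    obtain ⟨ψ₁, h₁⟩ := ih₁
    obtain ⟨ψ₂, h₂⟩ := ih₂
    exact ⟨ψ₁.imp ψ₂, fun i v x => by simp only [BoundedFormula.realize_imp, h₁, h₂]⟩
  | all _ ih =>
    obtain ⟨ψ, h⟩ := ih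
    exact ⟨ψ.all, fun i v x => by simp only [BoundedFormula.realize_all, h]⟩

end Translation

/-! ### Reducts of models of a definitional extension -/

section Extension

variable {L L' : FirstOrder.Language.{u, u}}

/-- The theory `T` together with explicit definitions of the symbols that are not in `L`. -/
def definitionTheory (e : L →ᴸ L') (T : L.Theory)
    (ρ : ∀ n : ℕ, L'.Relations n → L.Formula (Fin n))
    (γ : ∀ n : ℕ, L'.Functions n → L.Formula (Fin n ⊕ Unit)) : L'.Theory :=
  e.onTheory T ∪
    {τ | ∃ (n : ℕ) (R : L'.Relations n),
      R ∉ Set.range (fun S : L.Relations n => e.onRelation S) ∧ τ = relDefinition e R (ρ n R)} ∪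
    {τ | ∃ (n : ℕ) (f : L'.Functions n),
      f ∉ Set.range (fun g : L.Functions n => e.onFunction g) ∧ τ = funDefinition e f (γ n f)}

theorem model_definitionTheory_iff (e : L →ᴸ L') (T : L.Theory)
    (ρ : ∀ n : ℕ, L'.Relations n → L.Formula (Fin n))
    (γ : ∀ n : ℕ, L'.Functions n → L.Formula (Fin n ⊕ Unit)) (A : Type u)
    [L'.Structure A] [L.Structure A] [e.IsExpansionOn A] :
    A ⊨ definitionTheory e T ρ γ ↔ A ⊨ T ∧
      (∀ (n : ℕ) (R : L'.Relations n),
        R ∉ Set.range (fun S : L.Relations n => e.onRelation S) →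
        ∀ x : Fin n → A, Structure.RelMap R x ↔ (ρ n R).Realize x) ∧
      (∀ (n : ℕ) (f : L'.Functions n),
        f ∉ Set.range (fun g : L.Functions n => e.onFunction g) →
        ∀ (x : Fin n → A) (y : A),
          Structure.funMap f x = y ↔ (γ n f).Realize (Sum.elim x fun _ => y)) := by
  have hr (n : ℕ) (R : L'.Relations n) : A ⊨ relDefinition e R (ρ n R) ↔
      ∀ x : Fin n → A, Structure.RelMap R x ↔ (ρ n R).Realize x := by
    rw [relDefinition, realize_univClosure]
    simp only [Formula.realize_iff, LHom.realize_onFormula, Formula.realize_rel, Term.realize_var]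
  have hf (n : ℕ) (f : L'.Functions n) : A ⊨ funDefinition e f (γ n f) ↔
      ∀ (x : Fin n → A) (y : A),
        Structure.funMap f x = y ↔ (γ n f).Realize (Sum.elim x fun _ => y) := by
    rw [funDefinition, realize_univClosure]
    simp only [Formula.realize_iff, LHom.realize_onFormula, Formula.realize_equal,
      Term.realize_var, Term.realize_func]
    refine ⟨fun h x y => h (Sum.elim x fun _ => y), fun h v => ?_⟩
    have := h (v ∘ Sum.inl) (v (Sum.inr ()))
    have hv : (Sum.elim (v ∘ Sum.inl) fun _ : Unit => v (Sum.inr ())) = v := by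
      ext (a | a) <;> rfl
    rwa [hv] at this
  rw [definitionTheory, Theory.model_union_iff, Theory.model_union_iff, LHom.onTheory_model,
    and_assoc]
  refine and_congr Iff.rfl (and_congr ?_ ?_)
  · rw [Theory.model_iff]
    refine ⟨fun h n R hR => (hr n R).1 (h _ ⟨n, R, hR, rfl⟩), ?_⟩
    rintro h _ ⟨n, R, hR, rfl⟩
    exact (hr n R).2 (h n R hR)
  · rw [Theory.model_iff]
    refine ⟨fun h n f hf' => (hf n f).1 (h _ ⟨n, f, hf', rfl⟩), ?_⟩
    rintro h _ ⟨n, f, hf', rfl⟩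
    exact (hf n f).2 (h n f hf')

/-- Each axiom of either theory is a consequence of the other. -/
theorem model_iff_of_models_iff {T T' : L.Theory} (h : ∀ σ : L.Sentence, T ⊨ᵇ σ ↔ T' ⊨ᵇ σ)
    (A : Type u) [L.Structure A] [Nonempty A] : A ⊨ T ↔ A ⊨ T' := by
  refine ⟨fun hA => ⟨fun σ hσ => ?_⟩, fun hA => ⟨fun σ hσ => ?_⟩⟩
  · exact ((h σ).2 (Theory.models_sentence_of_mem hσ)).realize_sentence A
  · exact ((h σ).1 (Theory.models_sentence_of_mem hσ)).realize_sentence A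

variable {e : L →ᴸ L'} {T : L.Theory} {T' : L'.Theory}

/-- A model of a theory has an expansion to a model of a definitional extension. -/
theorem IsDefinitionalExtension.exists_expansion (he : e.Injective)
    (h : IsDefinitionalExtension e T T') (N : ModelCat T) :
    ∃ s : L'.Structure N.Carrier, @Theory.Model L' N.Carrier s T' ∧
      @LHom.reduct L L' e N.Carrier s = N.struc := by
  classical
  obtain ⟨ρ, γ, hfun, hT'⟩ := h
  have hγ (n : ℕ) (f : L'.Functions n)
      (hf : f ∉ Set.range (fun g : L.Functions n => e.onFunction g)) (x : Fin n → N.Carrier) :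
      ∃ y : N.Carrier, ∀ y', y = y' ↔ (γ n f).Realize (Sum.elim x fun _ => y') := by
    have := (hfun n f hf).realize_formula N.Carrier (v := x)
    rw [Formula.realize_iExsUnique] at this
    obtain ⟨y, hy, hy'⟩ := this
    exact ⟨y (), fun y' => ⟨fun h => h ▸ hy, fun h => (congrFun (hy' (fun _ => y') h) ()).symm⟩⟩
  -- Symbols from `L` are read in `N` through a chosen preimage, unique by injectivity of `e`; new
  -- symbols are read by their definitions.
  let s : L'.Structure N.Carrier :=
    { funMap := fun {n} f x =>
        if h : f ∈ Set.range (fun g : L.Functions n => e.onFunction g) then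
          Structure.funMap h.choose x
        else (hγ n f h x).choose
      RelMap := fun {n} R x =>
        if h : R ∈ Set.range (fun S : L.Relations n => e.onRelation S) then
          Structure.RelMap h.choose x
        else (ρ n R).Realize x }
  have hs : e.IsExpansionOn N.Carrier := by
    refine ⟨fun {n} f x => ?_, fun {n} R x => ?_⟩
    · have hf : e.onFunction f ∈ Set.range fun f : L.Functions n => e.onFunction f := ⟨f, rfl⟩
      refine (dif_pos hf).trans ?_
      rw [he.onFunction hf.choose_spec]
    · have hR : e.onRelation R ∈ Set.range fun R : L.Relations n => e.onRelation R := ⟨R, rfl⟩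
      refine (dif_pos hR).trans ?_
      rw [he.onRelation hR.choose_spec]
  refine ⟨s, ?_, ?_⟩
  · rw [model_iff_of_models_iff hT' N.Carrier]
    refine (model_definitionTheory_iff e T ρ γ N.Carrier).2
      ⟨N.is_model, fun n R hR x => ?_, fun n f hf x y => ?_⟩
    · exact iff_of_eq (dif_neg hR)
    · refine Iff.trans (Eq.congr_left (dif_neg hf)) ((hγ n f hf x).choose_spec y)
  · exact Structure.ext (funext fun n => funext fun f => funext fun x => hs.map_onFunction f x)
      (funext fun n => funext fun R => funext fun x => hs.map_onRelation R x)

theorem IsDefinitionalExtension.model_reduct (h : IsDefinitionalExtension e T T')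
    (M : ModelCat T') : @Theory.Model L M.Carrier (e.reduct M.Carrier) T := by
  obtain ⟨ρ, γ, -, hT'⟩ := h
  let : L.Structure M.Carrier := e.reduct M.Carrier
  exact ((model_definitionTheory_iff e T ρ γ M.Carrier).1
    ((model_iff_of_models_iff hT' M.Carrier).1 M.is_model)).1

/-- Symbols from `L` translate to themselves and new ones to their definitions. Through this,
reducts reflect elementary embeddings. -/
theorem IsDefinitionalExtension.exists_formula_translation (h : IsDefinitionalExtension e T T')
    {α : Type*} (φ : L'.Formula α) : ∃ ψ : L.Formula α, ∀ (M : ModelCat T') (v : α → M),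
      φ.Realize v ↔ @Formula.Realize L M.Carrier (e.reduct M.Carrier) α ψ v := by
  obtain ⟨ρ, γ, -, hT'⟩ := h
  let (M : ModelCat T') : L.Structure M.Carrier := e.reduct M.Carrier
  have hM (M : ModelCat T') := (model_definitionTheory_iff e T ρ γ M.Carrier).1
    ((model_iff_of_models_iff hT' M.Carrier).1 M.is_model)
  obtain ⟨ψ, hψ⟩ := DefEq.exists_formula_translation (L := L) (L' := L') (ι := ModelCat T')
    (A := fun M => M.Carrier)
    (fun n f => by
      by_cases hf : f ∈ Set.range (fun g : L.Functions n => e.onFunction g)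
      · obtain ⟨g, rfl⟩ := hf
        refine ⟨(Term.func g (fun i => Term.var (Sum.inl i))).equal (Term.var (Sum.inr ())),
          fun M x y => ?_⟩
        rw [Formula.realize_equal]
        exact Iff.rfl
      · exact ⟨γ n f, fun M => (hM M).2.2 n f hf⟩)
    (fun n R => by
      by_cases hR : R ∈ Set.range (fun S : L.Relations n => e.onRelation S)
      · obtain ⟨S, rfl⟩ := hR
        exact ⟨S.formula Term.var, fun M x => Iff.rfl⟩
      · exact ⟨ρ n R, fun M => (hM M).2.1 n R hR⟩) φ
  exact ⟨ψ, fun M v => hψ M v default⟩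

/-- Taking reducts is a correspondence between the models of a definitional extension and those of
the original theory. -/
def ConcreteEquiv.ofIsDefinitionalExtension (he : e.Injective)
    (h : IsDefinitionalExtension e T T') : ConcreteEquiv T' T where
  str M := e.reduct M.Carrier
  isModel := h.model_reduct
  isElem_iff M N f := by
    refine ⟨?_, ?_⟩
    · rintro ⟨g, rfl⟩
      let : L.Structure M.Carrier := e.reduct M.Carrier
      let : L.Structure N.Carrier := e.reduct N.Carrier
      refine ⟨@ElementaryEmbedding.mk L M.Carrier N.Carrier (e.reduct M.Carrier)
        (e.reduct N.Carrier) g fun n φ x => ?_, rfl⟩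
      rw [← LHom.realize_onFormula e φ, ← LHom.realize_onFormula e φ]
      exact g.map_formula (e.onFormula φ) x
    · rintro ⟨g, hg⟩
      refine ⟨ElementaryEmbedding.mk f fun n φ x => ?_, rfl⟩
      obtain ⟨ψ, hψ⟩ := h.exists_formula_translation φ
      rw [hψ, hψ, ← hg]
      exact @ElementaryEmbedding.map_formula L M.Carrier N.Carrier (e.reduct M.Carrier)
        (e.reduct N.Carrier) g _ ψ x
  surj N := by
    obtain @⟨A, t, ht, nt⟩ := N
    obtain ⟨s, hs, rfl⟩ : ∃ s : L'.Structure A, @Theory.Model L' A s T' ∧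
        @LHom.reduct L L' e A s = t :=
      h.exists_expansion he (@Theory.ModelType.mk L T A t ht nt)
    exact ⟨@Theory.ModelType.mk L' T' A s hs nt, rfl⟩
  -- Symbols of an ultraproduct are interpreted one at a time, so reduct and ultraproduct commute by
  -- definition.
  ultra I U M := rfl

end Extension

/-! ### The joint definitional extension -/

section Main

variable {L Lo L' : FirstOrder.Language.{u, u}} {T : L.Theory} {To : Lo.Theory}

/-- A correspondence between models of `T` and `To` is given by explicit definitions of the symbols
of `To`. -/
theorem ConcreteEquiv.exists_definitions (C : ConcreteEquiv T To) (e : L →ᴸ L') (eo : Lo →ᴸ L')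
    (heo : eo.Injective)
    (hfun : ∀ (n : ℕ) (f : L'.Functions n),
      f ∉ Set.range (fun g : L.Functions n => e.onFunction g) ↔
        f ∈ Set.range (fun g : Lo.Functions n => eo.onFunction g))
    (hrel : ∀ (n : ℕ) (R : L'.Relations n),
      R ∉ Set.range (fun S : L.Relations n => e.onRelation S) ↔
        R ∈ Set.range (fun S : Lo.Relations n => eo.onRelation S)) :
    ∃ (ρ : ∀ n : ℕ, L'.Relations n → L.Formula (Fin n))
      (γ : ∀ n : ℕ, L'.Functions n → L.Formula (Fin n ⊕ Unit)),
      (∀ (n : ℕ) (f : L'.Functions n),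
        f ∉ Set.range (fun g : L.Functions n => e.onFunction g) →
          T ⊨ᵇ (γ n f).iExsUnique Unit) ∧
      ∀ (A : Type u) (_ : L'.Structure A) (_ : Nonempty A), A ⊨ definitionTheory e T ρ γ ↔
        ∃ h : @Theory.Model L A (e.reduct A) T,
          C.str (@Theory.ModelType.mk L T A (e.reduct A) h inferInstance) = eo.reduct A := by
  have h1 (n : ℕ) (f : L'.Functions n) : ∃ γ : L.Formula (Fin n ⊕ Unit),
      ∀ g : Lo.Functions n, eo.onFunction g = f → ∀ (M : ModelCat T) (v : Fin n ⊕ Unit → M),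
        (C.str M).funMap g (v ∘ Sum.inl) = v (Sum.inr ()) ↔ γ.Realize v := by
    by_cases hf : f ∈ Set.range (fun g : Lo.Functions n => eo.onFunction g)
    · obtain ⟨g, rfl⟩ := hf
      obtain ⟨γ, hγ⟩ := C.exists_function_definition g
      refine ⟨γ, fun g' hg' => ?_⟩
      rwa [heo.onFunction hg']
    -- A dummy: symbols outside the range of `eo` come from `L` and receive no definition.
    · exact ⟨⊥, fun g hg => absurd ⟨g, hg⟩ hf⟩
  have h2 (n : ℕ) (R : L'.Relations n) : ∃ ρ : L.Formula (Fin n),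
      ∀ S : Lo.Relations n, eo.onRelation S = R → ∀ (M : ModelCat T) (v : Fin n → M),
        (C.str M).RelMap S v ↔ ρ.Realize v := by
    by_cases hR : R ∈ Set.range (fun S : Lo.Relations n => eo.onRelation S)
    · obtain ⟨S, rfl⟩ := hR
      obtain ⟨ρ, hρ⟩ := C.exists_relation_definition S
      refine ⟨ρ, fun S' hS' => ?_⟩
      rwa [heo.onRelation hS']
    · exact ⟨⊥, fun S hS => absurd ⟨S, hS⟩ hR⟩
  choose γ hγ using h1
  choose ρ hρ using h2
  refine ⟨ρ, γ, fun n f hf => ?_, fun A s hA => ?_⟩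
  · obtain ⟨g, hg⟩ := (hfun n f).1 hf
    refine Theory.models_formula_iff.2 fun M v => ?_
    rw [Formula.realize_iExsUnique]
    refine ⟨fun _ => (C.str M).funMap g v, ?_, fun y hy => ?_⟩
    · exact (hγ n f g hg M (Sum.elim v fun _ => (C.str M).funMap g v)).1 rfl
    · exact funext fun _ => ((hγ n f g hg M (Sum.elim v y)).2 hy).symm
  · let : L.Structure A := e.reduct A
    rw [model_definitionTheory_iff]
    constructor
    · rintro ⟨hT, hR, hf⟩
      refine ⟨hT, ?_⟩
      let M : ModelCat T := Theory.ModelType.mk A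
      refine Structure.ext (funext fun n => funext fun g => funext fun x => ?_)
        (funext fun n => funext fun S => funext fun x => propext ?_)
      · exact (hγ n _ g rfl M (Sum.elim x fun _ => Structure.funMap (eo.onFunction g) x)).2
          ((hf n _ ((hfun n _).2 ⟨g, rfl⟩) x _).1 rfl)
      · exact (hρ n _ S rfl M x).trans (hR n _ ((hrel n _).2 ⟨S, rfl⟩) x).symm
    · rintro ⟨hT, hstr⟩
      let M : ModelCat T := Theory.ModelType.mk A
      refine ⟨hT, fun n R hR x => ?_, fun n f hf x y => ?_⟩
      · obtain ⟨S, rfl⟩ := (hrel n R).1 hR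
        rw [← hρ n _ S rfl M x]
        change _ ↔ (C.str (Theory.ModelType.mk A)).RelMap S x
        rw [hstr]
        exact Iff.rfl
      · obtain ⟨g, rfl⟩ := (hfun n f).1 hf
        rw [← hγ n _ g rfl M (Sum.elim x fun _ => y)]
        change _ ↔ (C.str (Theory.ModelType.mk A)).funMap g x = y
        rw [hstr]
        exact Iff.rfl

/-- The models of the joint extension are described in the same way from both sides. -/
theorem ConcreteEquiv.str_eq_of_symm_str_eq (C : ConcreteEquiv T To) {A : Type u} [Nonempty A]
    (s : L.Structure A) (t : Lo.Structure A)
    (h : ∃ h : @Theory.Model L A s T, C.str (@Theory.ModelType.mk L T A s h inferInstance) = t) :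
    ∃ h : @Theory.Model Lo A t To,
      C.symm.str (@Theory.ModelType.mk Lo To A t h inferInstance) = s := by
  obtain ⟨h, rfl⟩ := h
  refine ⟨C.isModel (@Theory.ModelType.mk L T A s h inferInstance), ?_⟩
  have := C.symm_obj_obj (@Theory.ModelType.mk L T A s h inferInstance)
  injection this

/-- Both sides describe the same pairs of structures on `A`, so the definitions from either side
have the same models. -/
theorem ConcreteEquiv.symm_str_eq_iff (C : ConcreteEquiv T To) {A : Type u} [Nonempty A]
    (s : L.Structure A) (t : Lo.Structure A) :
    (∃ h : @Theory.Model Lo A t To,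
      C.symm.str (@Theory.ModelType.mk Lo To A t h inferInstance) = s) ↔
    ∃ h : @Theory.Model L A s T,
      C.str (@Theory.ModelType.mk L T A s h inferInstance) = t := by
  refine ⟨?_, C.str_eq_of_symm_str_eq s t⟩
  rintro ⟨h, rfl⟩
  refine ⟨C.symm.isModel (@Theory.ModelType.mk Lo To A t h inferInstance), ?_⟩
  have := C.obj_symm_obj (@Theory.ModelType.mk Lo To A t h inferInstance)
  injection this

theorem models_iff_of_model_iff {T T' : L.Theory}
    (h : ∀ (A : Type u) [L.Structure A] [Nonempty A], A ⊨ T ↔ A ⊨ T') (σ : L.Sentence) :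
    T ⊨ᵇ σ ↔ T' ⊨ᵇ σ := by
  rw [Theory.models_sentence_iff, Theory.models_sentence_iff]
  refine ⟨fun hT M => ?_, fun hT M => ?_⟩
  · have : M.Carrier ⊨ T := (h M.Carrier).2 M.is_model
    exact hT (Theory.ModelType.mk M.Carrier)
  · have : M.Carrier ⊨ T' := (h M.Carrier).1 M.is_model
    exact hT (Theory.ModelType.mk M.Carrier)

theorem notMem_range_inl_iff {α β : Type*} (x : α ⊕ β) :
    x ∉ Set.range (fun a : α => (Sum.inl a : α ⊕ β)) ↔
      x ∈ Set.range (fun b : β => (Sum.inr b : α ⊕ β)) := by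
  cases x <;> simp

theorem notMem_range_inr_iff {α β : Type*} (x : α ⊕ β) :
    x ∉ Set.range (fun b : β => (Sum.inr b : α ⊕ β)) ↔
      x ∈ Set.range (fun a : α => (Sum.inl a : α ⊕ β)) := by
  cases x <;> simp

theorem ConcreteEquiv.definitionallyEquivalent (C : ConcreteEquiv T To) :
    DefinitionallyEquivalent T To := by
  obtain ⟨ρ, γ, hγ, h⟩ := C.exists_definitions (L' := L.sum Lo) LHom.sumInl LHom.sumInr
    LHom.sumInr_injective
    (fun n f => notMem_range_inl_iff f)
    (fun n f => notMem_range_inl_iff f)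
  obtain ⟨ρ', γ', hγ', h'⟩ := C.symm.exists_definitions (L' := L.sum Lo) LHom.sumInr LHom.sumInl
    LHom.sumInl_injective
    (fun n f => notMem_range_inr_iff f)
    (fun n f => notMem_range_inr_iff f)
  refine ⟨L.sum Lo, LHom.sumInl, LHom.sumInr, definitionTheory LHom.sumInl T ρ γ,
    LHom.sumInl_injective, LHom.sumInr_injective, fun n => ?_, fun n => ?_,
    ⟨ρ, γ, hγ, fun σ => Iff.rfl⟩, ρ', γ', hγ', models_iff_of_model_iff fun A s hA => ?_⟩
  · rw [Set.disjoint_left]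
    rintro _ ⟨f, rfl⟩ ⟨g, hg⟩
    exact Sum.inr_ne_inl hg
  · rw [Set.disjoint_left]
    rintro _ ⟨f, rfl⟩ ⟨g, hg⟩
    exact Sum.inr_ne_inl hg
  · exact (h A s hA).trans ((C.symm_str_eq_iff _ _).symm.trans (h' A s hA).symm)

/-- Expand a model of `T` to the joint extension, then take the reduct to the language of `To`. -/
theorem DefinitionallyEquivalent.nonempty_concreteEquiv (h : DefinitionallyEquivalent T To) :
    Nonempty (ConcreteEquiv T To) := by
  obtain ⟨L', e₁, e₂, T', he₁, he₂, -, -, h₁, h₂⟩ := h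
  exact ⟨(ConcreteEquiv.ofIsDefinitionalExtension he₁ h₁).symm.trans
    (ConcreteEquiv.ofIsDefinitionalExtension he₂ h₂)⟩

end Main

end DefEq

theorem mainTheorem3 {L₁ L₂ : FirstOrder.Language.{u, u}} (T₁ : L₁.Theory) (T₂ : L₂.Theory) :
    DefEq.DefinitionallyEquivalent T₁ T₂ ↔
      ∃ F : DefEq.ModelCat T₁ ⥤ DefEq.ModelCat T₂,
        DefEq.IsConcrete F ∧ DefEq.PreservesUltraproducts F ∧ F.IsEquivalence := by
  constructor
  · intro h
    obtain ⟨C⟩ := h.nonempty_concreteEquiv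
    exact ⟨C.functor, C.isConcrete_functor, C.ultra, C.isEquivalence_functor⟩
  · rintro ⟨F, hF, hU, hE⟩
    obtain ⟨C⟩ := DefEq.ConcreteEquiv.nonempty_of_functor F hF hU hE
    exact C.definitionallyEquivalent
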